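/- \textbf{Theorem (Consistency and local power).} Let $q_1,q_0\ge 1$ be fixed integers, $q=q_1+q_0$, $\alpha\in(0,1)$. For $x\in\mathbb{R}^q$ let \[T(x)=\frac1{q_1}\sum_{k=1}^{q_1}x_k-\frac1{q_0}\sum_{k=q_1+1}^{q}x_k .\] Let $\mathfrak{G}$ be the set of permutations $g$ of $\{1,\dots,q\}$ with $g(1)<\dots<g(q_1)$ and $g(q_1+1)<\dots<g(q)$, let $gx=(x_{g(1)},\dots,x_{g(q)})$, let $T^{(1)}(x,\mathfrak{G})\le\dots\le T^{(|\mathfrak{G}|)}(x,\mathfrak{G})$ be the ordered values of $T(gx)$, $g\in\mathfrak{G}$, and put $T^{p}(x,\mathfrak{G})=T^{(\lceil(1-p)|\mathfrak{G}|\rceil)}(x,\mathfrak{G})$ for $p\in[0,1)$. Let $\bar\alpha$ be the largest $p\in\{0,1/|\mathfrak{G}|,\dots,(|\mathfrak{G}|-1)/|\mathfrak{G}|\}$ such that \[\sup_{\mu\in\mathbb{R},\ \sigma_1,\dots,\sigma_q>0}\mathbb{P}\bigl(T(X)>T^{p}(X,\mathfrak{G})\bigr)\le\alpha,\] where $X$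 has independent entries $X_k\sim N(\mu,\sigma_k^2)$. For each sample size $n$ let $\mathbb{P}_\theta=\mathbb{P}_{n,\theta}$, $\theta=(\theta_1,\theta_0)\in\mathbb{R}^2$, be the possible distributions of the data, let $\hat\theta_n=(\hat\theta_{n,1},\dots,\hat\theta_{n,q})$ be an $\mathbb{R}^q$-valued statistic, and let $\sigma_1,\dots,\sigma_q$ be real functions on $\mathbb{R}$. Say that (C) holds under $\theta=(\theta_1,\theta_0)$, which may depend on $n$, if as $n\to\infty$ \[\sqrt n\left(\frac{\hat\theta_{n,1}-\theta_1}{\sigma_1(\theta_1)},\dots,\frac{\hat\theta_{n,q_1}-\theta_1}{\sigma_{q_1}(\theta_1)},\frac{\hat\theta_{n,q_1+1}-\theta_0}{\sigma_{q_1+1}(\theta_0)},\dots,\frac{\hat\theta_{n,q}-\theta_0}{\sigma_q(\theta_0)}\right)\ \text{converges weakly to } N(0,I_q)\ \text{under } \mathbb{P}_\theta .\] Fix $\theta_0\in\mathbb{R}$. (i) If (C) holds under $\theta=(\theta_0,\theta_0)$, then the following limit exists and \[\lim_{n\to\infty}\mathbb{P}_\theta\bigl(T(\hat\theta_n)>T^{\bar\alpha}(\hat\theta_n,\mathfrak{G})\bigr)\le\alpha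 .\] Suppose in addition that $\bar\alpha\ge 1/|\mathfrak{G}|$. (ii) If $\delta>0$ and (C) holds under $\theta=(\theta_0+\delta,\theta_0)$, then $\mathbb{P}_\theta\bigl(T(\hat\theta_n)>T^{\bar\alpha}(\hat\theta_n,\mathfrak{G})\bigr)\to 1$. (iii) If $\delta\in\mathbb{R}$, (C) holds under the sequence $\theta_n=(\theta_0+\delta/\sqrt n,\theta_0)$, and $\sigma_1,\dots,\sigma_q$ are continuous and positive at $\theta_0$, then the following limit exists and \[\lim_{n\to\infty}\mathbb{P}_{\theta_n}\bigl(T(\hat\theta_n)>T^{\bar\alpha}(\hat\theta_n,\mathfrak{G})\bigr)\ \ge\ \int_0^1\prod_{j=1}^{q_1}\Phi\!\left(\frac{\delta-F_{0,\theta_0}^{-1}(t)}{\sigma_j(\theta_0)}\right)dt ,\] where $\Phi$ is the standard normal distribution function and $F_{0,\theta_0}$ is the distribution function of $\max_{1\le k\le q_0}\sigma_{q_1+k}(\theta_0)Z_k$ with $Z_1,\dots,Z_{q_0}$ independent standard normal. -/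

import Mathlib

open MeasureTheory ProbabilityTheory Filter Topology
open scoped ENNReal

noncomputable section

namespace PermTest

/-- The comparison of means `T(x)`: average of the first `q₁` coordinates (treated clusters)
minus average of the last `q₀` coordinates (control clusters). -/
def diffMeans (q₁ q₀ : ℕ) (x : Fin (q₁ + q₀) → ℝ) : ℝ :=
  (∑ k : Fin q₁, x (Fin.castAdd q₀ k)) / q₁ - (∑ k : Fin q₀, x (Fin.natAdd q₁ k)) / q₀

/-- The set `𝔊` of permutations `g` of the indices with `g(1) < ⋯ < g(q₁)` and
`g(q₁ + 1) < ⋯ < g(q₁ + q₀)`. -/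
def permSet (q₁ q₀ : ℕ) : Finset (Equiv.Perm (Fin (q₁ + q₀))) :=
  open Classical in
  Finset.univ.filter fun g =>
    StrictMono (fun k : Fin q₁ => g (Fin.castAdd q₀ k)) ∧
      StrictMono (fun k : Fin q₀ => g (Fin.natAdd q₁ k))

/-- The permutation statistics `T(gx)`, `g ∈ 𝔊`, with `gx = (x_{g(1)}, …, x_{g(q)})`, listed with
multiplicity in increasing order. -/
def permStats (q₁ q₀ : ℕ) (x : Fin (q₁ + q₀) → ℝ) : List ℝ :=
  ((permSet q₁ q₀).val.map fun g => diffMeans q₁ q₀ fun k => x (g k)).sort (· ≤ ·)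

/-- The `j`-th order statistic `T^{(j)}(x, 𝔊)`, for `1 ≤ j ≤ |𝔊|` (the default value `0` is only
used outside of this range). -/
def orderStat (q₁ q₀ : ℕ) (j : ℕ) (x : Fin (q₁ + q₀) → ℝ) : ℝ :=
  (permStats q₁ q₀ x).getD (j - 1) 0

/-- The critical value `T^p(x, 𝔊) = T^{(⌈(1 - p)|𝔊|⌉)}(x, 𝔊)`. -/
def critVal (q₁ q₀ : ℕ) (p : ℝ) (x : Fin (q₁ + q₀) → ℝ) : ℝ :=
  orderStat q₁ q₀ ⌈(1 - p) * ((permSet q₁ q₀).card : ℝ)⌉₊ x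

/-- The permutation test with nominal level `p` rejects at `x`: `T(x) > T^p(x, 𝔊)`. -/
def Rejects (q₁ q₀ : ℕ) (p : ℝ) (x : Fin (q₁ + q₀) → ℝ) : Prop :=
  critVal q₁ q₀ p x < diffMeans q₁ q₀ x

/-- The law of a vector with independent entries `X_k ∼ N(μ, σ_k²)`. -/
def normalLaw {q : ℕ} (μ : ℝ) (σ : Fin q → ℝ) : Measure (Fin q → ℝ) :=
  Measure.pi fun k => gaussianReal μ (σ k ^ 2).toNNReal

/-- The worst-case size `sup_{μ ∈ ℝ, σ₁, …, σ_q > 0} P(T(X) > T^p(X, 𝔊))` over independent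
normal `X_k ∼ N(μ, σ_k²)`. -/
def worstSize (q₁ q₀ : ℕ) (p : ℝ) : ℝ≥0∞ :=
  ⨆ (μ : ℝ) (σ : Fin (q₁ + q₀) → ℝ) (_ : ∀ k, 0 < σ k),
    normalLaw μ σ {x | Rejects q₁ q₀ p x}

/-- The adjusted level `ᾱ`: the largest `p ∈ {0, 1/|𝔊|, …, (|𝔊| - 1)/|𝔊|}` whose worst-case size
is at most `α`. -/
def alphaBar (q₁ q₀ : ℕ) (α : ℝ) : ℝ :=
  sSup {p : ℝ | (∃ i : ℕ, i < (permSet q₁ q₀).card ∧ p = i / (permSet q₁ q₀).card) ∧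
    worstSize q₁ q₀ p ≤ ENNReal.ofReal α}

/-- The parameter estimated in cluster `k` under `θ = (θ₁, θ₀)`: `θ₁` in the first `q₁` clusters
and `θ₀` in the others. -/
def clusterParam (q₁ q₀ : ℕ) (θ : ℝ × ℝ) (k : Fin (q₁ + q₀)) : ℝ :=
  if (k : ℕ) < q₁ then θ.1 else θ.2

/-- The centered and scaled estimates: the vector with entries
`√n (x_k - θ₁) / σ_k(θ₁)` for `k ≤ q₁` and `√n (x_k - θ₀) / σ_k(θ₀)` for `k > q₁`. -/
def standardize (q₁ q₀ : ℕ) (σ : Fin (q₁ + q₀) → ℝ → ℝ) (n : ℕ) (θ : ℝ × ℝ)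
    (x : Fin (q₁ + q₀) → ℝ) : Fin (q₁ + q₀) → ℝ :=
  fun k => √(n : ℝ) * ((x k - clusterParam q₁ q₀ θ k) / σ k (clusterParam q₁ q₀ θ k))

/-- The joint convergence condition along a sequence of parameters `θ n = (θ₁, θ₀)`: under the
data distributions `P n (θ n)`, the centered and scaled estimates converge weakly to the
`q`-dimensional standard normal distribution. -/
def JointConv (q₁ q₀ : ℕ) (σ : Fin (q₁ + q₀) → ℝ → ℝ) {Ω : ℕ → Type*}
    [∀ n, MeasurableSpace (Ω n)] (P : (n : ℕ) → ℝ × ℝ → Measure (Ω n))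
    [∀ n θ, IsProbabilityMeasure (P n θ)] (θhat : (n : ℕ) → Ω n → Fin (q₁ + q₀) → ℝ)
    (θ : ℕ → ℝ × ℝ) : Prop :=
  TendstoInDistribution (fun n ω => standardize q₁ q₀ σ n (θ n) (θhat n ω)) atTop
    (id : (Fin (q₁ + q₀) → ℝ) → Fin (q₁ + q₀) → ℝ) (fun n => P n (θ n))
    (Measure.pi fun _ => gaussianReal 0 1)

/-- The probability, under parameter `θ` and sample size `n`, that the adjusted permutation test
rejects: `P_θ(T(θ̂_n) > T^{ᾱ}(θ̂_n, 𝔊))`. -/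
def rejProb (q₁ q₀ : ℕ) (α : ℝ) {Ω : ℕ → Type*} [∀ n, MeasurableSpace (Ω n)]
    (P : (n : ℕ) → ℝ × ℝ → Measure (Ω n)) (θhat : (n : ℕ) → Ω n → Fin (q₁ + q₀) → ℝ)
    (n : ℕ) (θ : ℝ × ℝ) : ℝ :=
  (P n θ).real {ω | Rejects q₁ q₀ (alphaBar q₁ q₀ α) (θhat n ω)}

/-- The standard normal distribution function `Φ`. -/
def stdNormalCDF (x : ℝ) : ℝ := cdf (gaussianReal 0 1) x

/-- The distribution function of `max_{1 ≤ k ≤ q₀} s_k Z_k`, with `Z_1, …, Z_{q₀}` independent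
standard normal. -/
def maxCDF (q₀ : ℕ) (s : Fin q₀ → ℝ) (x : ℝ) : ℝ :=
  cdf ((Measure.pi fun _ : Fin q₀ => gaussianReal 0 1).map fun z => ⨆ k, s k * z k) x

/-- The inverse of a distribution function `F`. -/
def invCDF (F : ℝ → ℝ) (t : ℝ) : ℝ := sInf {x | t ≤ F x}

end PermTest

end

namespace PermTest

/-! The decision depends on `x` only through the number of `g ∈ 𝔊` with `T(gx) < T(x)`
(`rejects_iff`). This count is invariant under `x ↦ a(x - b)`, `a > 0` (`below_affine`), and locally
constant wherever no `g ≠ 1` ties with the identity (`eventually_below_eq`). If a count-preserving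
transformation of the estimates is a continuously convergent function of the standardized vector,
with limit `Y(Z)` a.s. free of ties, the rejection probability converges to that of `Y(Z)`
(`JointConv.tendsto_rejProb`).

In (i), `Y(Z)` is a centered normal vector, so `μ = 0` in the worst-case size bounds the limit. In
(ii), `Y` is the constant parameter vector; its treated entries exceed its control entries, so the
identity is the unique maximizer (`diffMeans_perm_lt`), and `ᾱ ≥ 1/|𝔊|` makes that enough to reject.
In (iii), `Y(Z)` is normal with treated entries shifted by `δ`; rejection is certain when every
treated entry exceeds the largest control entry, and `measureReal_max_lt` evaluates the probability
of this event. -/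

lemma getD_lt_iff_of_sorted {l : List ℝ} (hl : l.Pairwise (· ≤ ·)) {i : ℕ} (hi : i < l.length)
    (t : ℝ) : l.getD i 0 < t ↔ i < (l.countP fun a => decide (a < t)) := by
  induction l generalizing i with
  | nil => simp at hi
  | cons a l ih =>
    rw [List.pairwise_cons] at hl
    by_cases ha : a < t
    · cases i with
      | zero => simp [ha]
      | succ i =>
        rw [List.getD_cons_succ, ih hl.2 (by simpa using hi)]
        simp [ha]
    · have h0 : (l.countP fun a => decide (a < t)) = 0 := by
        rw [List.countP_eq_zero]
        intro b hb
        simpa using (not_lt.1 ha).trans (hl.1 b hb)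
      have hmem : ∀ b ∈ a :: l, t ≤ b := by
        intro b hb
        rcases List.mem_cons.1 hb with rfl | hb
        · exact not_lt.1 ha
        · exact (not_lt.1 ha).trans (hl.1 b hb)
      have h1 : ¬ (a :: l).getD i 0 < t := by
        rw [List.getD_eq_getElem _ _ hi]
        exact not_lt.2 (hmem _ (List.getElem_mem _))
      refine iff_of_false h1 ?_
      simp [ha, h0]

/-! ### Rejection as a count of permutations -/

variable {q₁ q₀ : ℕ}

lemma one_mem_permSet (q₁ q₀ : ℕ) : (1 : Equiv.Perm (Fin (q₁ + q₀))) ∈ permSet q₁ q₀ := by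
  classical
  simp only [permSet, Finset.mem_filter, Finset.mem_univ, true_and, Equiv.Perm.coe_one, id]
  exact ⟨Fin.strictMono_castAdd _, Fin.strictMono_natAdd _⟩

lemma card_permSet_pos (q₁ q₀ : ℕ) : 0 < (permSet q₁ q₀).card :=
  Finset.card_pos.2 ⟨1, one_mem_permSet q₁ q₀⟩

/-- The permutations in `𝔊` whose statistic lies strictly below `T(x)`. -/
noncomputable def below (q₁ q₀ : ℕ) (x : Fin (q₁ + q₀) → ℝ) : Finset (Equiv.Perm (Fin (q₁ + q₀))) :=
  (permSet q₁ q₀).filter fun g => diffMeans q₁ q₀ (fun k => x (g k)) < diffMeans q₁ q₀ x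

/-- The index of the order statistic that serves as critical value. -/
noncomputable def critIndex (q₁ q₀ : ℕ) (p : ℝ) : ℕ := ⌈(1 - p) * ((permSet q₁ q₀).card : ℝ)⌉₊

/-- The `j`-th smallest value is below `T(x)` exactly when at least `j` values are. The list is
indexed from 0, so the bounds on `j` make position `j - 1` meaningful and keep the default value out
of play. -/
lemma rejects_iff {p : ℝ} (h1 : 1 ≤ critIndex q₁ q₀ p)
    (h2 : critIndex q₁ q₀ p ≤ (permSet q₁ q₀).card) (x : Fin (q₁ + q₀) → ℝ) :
    Rejects q₁ q₀ p x ↔ critIndex q₁ q₀ p ≤ (below q₁ q₀ x).card := by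
  have hlen : (permStats q₁ q₀ x).length = (permSet q₁ q₀).card := by
    simp [permStats]
  have hcount : ((permStats q₁ q₀ x).countP fun a => decide (a < diffMeans q₁ q₀ x)) =
      (below q₁ q₀ x).card := by
    have := Multiset.coe_countP (fun a => a < diffMeans q₁ q₀ x) (permStats q₁ q₀ x)
    rw [← this, permStats, Multiset.sort_eq, Multiset.countP_map]
    rfl
  unfold Rejects critVal orderStat
  change (permStats q₁ q₀ x).getD (critIndex q₁ q₀ p - 1) 0 < _ ↔ _
  rw [getD_lt_iff_of_sorted (by unfold permStats; exact Multiset.pairwise_sort _ _) (by omega),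
    hcount]
  omega

lemma diffMeans_affine (hq₁ : 1 ≤ q₁) (hq₀ : 1 ≤ q₀) (a b : ℝ) (x : Fin (q₁ + q₀) → ℝ) :
    diffMeans q₁ q₀ (fun k => a * (x k - b)) = a * diffMeans q₁ q₀ x := by
  have h1 : (q₁ : ℝ) ≠ 0 := by positivity
  have h0 : (q₀ : ℝ) ≠ 0 := by positivity
  simp only [diffMeans, ← Finset.mul_sum, Finset.sum_sub_distrib, Finset.sum_const,
    Finset.card_univ, Fintype.card_fin, nsmul_eq_mul]
  field_simp
  ring

lemma below_affine (hq₁ : 1 ≤ q₁) (hq₀ : 1 ≤ q₀) {a : ℝ} (ha : 0 < a) (b : ℝ)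
    (x : Fin (q₁ + q₀) → ℝ) : below q₁ q₀ (fun k => a * (x k - b)) = below q₁ q₀ x := by
  unfold below
  refine Finset.filter_congr fun g _ => ?_
  rw [diffMeans_affine hq₁ hq₀ a b x, diffMeans_affine hq₁ hq₀ a b fun k => x (g k)]
  exact mul_lt_mul_iff_right₀ ha

/-! ### Separated vectors: the identity is the unique maximizer -/

/-- Otherwise `g` preserves both blocks, and a strictly increasing self-map of `Fin n` is the
identity. -/
lemma exists_crossing {g : Equiv.Perm (Fin (q₁ + q₀))} (hg : g ∈ permSet q₁ q₀) (h1 : g ≠ 1) :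
    ∃ (i : Fin q₁) (j : Fin q₀), g (Fin.castAdd q₀ i) = Fin.natAdd q₁ j := by
  classical
  simp only [permSet, Finset.mem_filter, Finset.mem_univ, true_and] at hg
  by_contra! h
  have hex : ∀ i : Fin q₁, ∃ i' : Fin q₁, g (Fin.castAdd q₀ i) = Fin.castAdd q₀ i' := by
    intro i
    generalize hk : g (Fin.castAdd q₀ i) = k
    induction k using Fin.addCases with
    | left i' => exact ⟨i', rfl⟩
    | right j => exact absurd hk (h i j)
  choose f hf using hex
  have hfm : StrictMono f := fun a b hab => by
    have := hg.1 hab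
    simp only [hf] at this
    exact (Fin.strictMono_castAdd q₀).lt_iff_lt.1 this
  have hfid : ∀ i, f i = i := fun i => congrFun hfm.eq_id i
  have hex' : ∀ j : Fin q₀, ∃ j' : Fin q₀, g (Fin.natAdd q₁ j) = Fin.natAdd q₁ j' := by
    intro j
    generalize hk : g (Fin.natAdd q₁ j) = k
    induction k using Fin.addCases with
    | left i' =>
      have : g (Fin.natAdd q₁ j) = g (Fin.castAdd q₀ i') := by rw [hk, hf, hfid]
      have := congrArg Fin.val (g.injective this)
      simp at this
      omega
    | right j' => exact ⟨j', rfl⟩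
  choose f' hf' using hex'
  have hfm' : StrictMono f' := fun a b hab => by
    have := hg.2 hab
    simpa only [hf', Fin.natAdd_lt_natAdd_iff] using this
  apply h1
  ext k : 1
  refine Fin.addCases (fun i => ?_) (fun j => ?_) k
  · rw [hf, hfid]; rfl
  · rw [hf', congrFun hfm'.eq_id j]; rfl

/-- If a threshold separates the treated from the control entries, the identity is the unique
maximizer of the permutation statistic. -/
lemma diffMeans_perm_lt (hq₁ : 1 ≤ q₁) (hq₀ : 1 ≤ q₀) {x : Fin (q₁ + q₀) → ℝ} {c : ℝ}
    (hfirst : ∀ i, c < x (Fin.castAdd q₀ i)) (hlast : ∀ j, x (Fin.natAdd q₁ j) ≤ c)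
    {g : Equiv.Perm (Fin (q₁ + q₀))} (hg : g ∈ permSet q₁ q₀) (h1 : g ≠ 1) :
    diffMeans q₁ q₀ (fun k => x (g k)) < diffMeans q₁ q₀ x := by
  classical
  obtain ⟨i₀, j₀, hij⟩ := exists_crossing hg h1
  have p1 : (0 : ℝ) < q₁ := by positivity
  have p0 : (0 : ℝ) < q₀ := by positivity
  have key : ∑ i : Fin q₁, x (g (Fin.castAdd q₀ i)) < ∑ i : Fin q₁, x (Fin.castAdd q₀ i) := by
    -- `A` collects the indices that `g` puts in treated slots, `B` the treated block. They have
    -- equal size, so `c` may be subtracted throughout; then terms are positive on `B` and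
    -- nonpositive off it, and `A ≠ B` loses strictly.
    let A := (Finset.univ : Finset (Fin q₁)).image fun i => g (Fin.castAdd q₀ i)
    let B := (Finset.univ : Finset (Fin q₁)).image fun i => Fin.castAdd q₀ i
    have hA : ∀ f : Fin (q₁ + q₀) → ℝ, ∑ k ∈ A, f k = ∑ i : Fin q₁, f (g (Fin.castAdd q₀ i)) :=
      fun f => Finset.sum_image fun a _ b _ hab =>
        Fin.castAdd_injective _ _ (g.injective hab)
    have hB : ∀ f : Fin (q₁ + q₀) → ℝ, ∑ k ∈ B, f k = ∑ i : Fin q₁, f (Fin.castAdd q₀ i) :=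
      fun f => Finset.sum_image fun a _ b _ hab => Fin.castAdd_injective _ _ hab
    have hAc : A.card = q₁ :=
      (Finset.card_image_of_injective Finset.univ
        (g.injective.comp (Fin.castAdd_injective q₁ q₀))).trans (by simp)
    have hBc : B.card = q₁ := by
      simpa using Finset.card_image_of_injective Finset.univ (Fin.castAdd_injective q₁ q₀)
    have hBmem : ∀ i, Fin.castAdd q₀ i ∈ B := fun i => Finset.mem_image_of_mem _ (Finset.mem_univ i)
    have hBpos : ∀ k ∈ B, 0 < x k - c := by
      intro k hk
      obtain ⟨i, -, rfl⟩ := Finset.mem_image.1 hk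
      linarith [hfirst i]
    have hBneg : ∀ k ∉ B, x k - c ≤ 0 := by
      intro k hk
      induction k using Fin.addCases with
      | left i => exact absurd (hBmem i) hk
      | right j => linarith [hlast j]
    have hne : ∃ k ∈ B, k ∉ A := by
      by_contra! hsub
      have hBA : B = A := Finset.eq_of_subset_of_card_le hsub (by rw [hAc, hBc])
      have hmem : Fin.natAdd q₁ j₀ ∈ B := by
        rw [hBA, ← hij]; exact Finset.mem_image_of_mem _ (Finset.mem_univ i₀)
      obtain ⟨i, -, hi⟩ := Finset.mem_image.1 hmem
      have := congrArg Fin.val hi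
      simp at this
      omega
    obtain ⟨k₀, hk₀B, hk₀A⟩ := hne
    have hlt : ∑ k ∈ A, (x k - c) < ∑ k ∈ B, (x k - c) := by
      rw [← Finset.sum_filter_add_sum_filter_not A (· ∈ B)]
      have s1 : ∑ k ∈ A with k ∉ B, (x k - c) ≤ 0 :=
        Finset.sum_nonpos fun k hk => hBneg k (Finset.mem_filter.1 hk).2
      have s2 : ∑ k ∈ A with k ∈ B, (x k - c) < ∑ k ∈ B, (x k - c) := by
        refine Finset.sum_lt_sum_of_subset (i := k₀) (fun k hk => (Finset.mem_filter.1 hk).2)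
          hk₀B (fun h => hk₀A (Finset.mem_filter.1 h).1) (hBpos _ hk₀B)
          fun k hk _ => (hBpos k hk).le
      linarith
    rw [Finset.sum_sub_distrib, Finset.sum_sub_distrib, Finset.sum_const, Finset.sum_const, hAc,
      hBc, hA, hB] at hlt
    linarith
  have htot : ∑ i : Fin q₁, x (g (Fin.castAdd q₀ i)) + ∑ j : Fin q₀, x (g (Fin.natAdd q₁ j)) =
      ∑ i : Fin q₁, x (Fin.castAdd q₀ i) + ∑ j : Fin q₀, x (Fin.natAdd q₁ j) := by
    rw [← Fin.sum_univ_add (fun k => x (g k)), ← Fin.sum_univ_add, Equiv.sum_comp g x]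
  have key' : ∑ j : Fin q₀, x (Fin.natAdd q₁ j) < ∑ j : Fin q₀, x (g (Fin.natAdd q₁ j)) := by
    linarith
  unfold diffMeans
  have := div_lt_div_of_pos_right key p1
  have := div_lt_div_of_pos_right key' p0
  linarith

lemma below_eq_erase (hq₁ : 1 ≤ q₁) (hq₀ : 1 ≤ q₀) {x : Fin (q₁ + q₀) → ℝ} {c : ℝ}
    (hfirst : ∀ i, c < x (Fin.castAdd q₀ i)) (hlast : ∀ j, x (Fin.natAdd q₁ j) ≤ c) :
    (below q₁ q₀ x).card = (permSet q₁ q₀).card - 1 := by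
  classical
  rw [← Finset.card_erase_of_mem (one_mem_permSet q₁ q₀)]
  congr 1
  ext g
  rw [below, Finset.mem_filter, Finset.mem_erase]
  constructor
  · rintro ⟨hg, hlt⟩
    refine ⟨?_, hg⟩
    rintro rfl
    exact lt_irrefl _ hlt
  · rintro ⟨h1, hg⟩
    exact ⟨hg, diffMeans_perm_lt hq₁ hq₀ hfirst hlast hg h1⟩

/-! ### Local constancy and measurability of the decision -/

/-- The permutation statistics of `x` over `𝔊 ∖ {1}` all differ from `T(x)`. -/
def Nondegenerate (q₁ q₀ : ℕ) (x : Fin (q₁ + q₀) → ℝ) : Prop :=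
  ∀ g ∈ permSet q₁ q₀, g ≠ 1 → diffMeans q₁ q₀ (fun k => x (g k)) ≠ diffMeans q₁ q₀ x

lemma continuous_diffMeans : Continuous (diffMeans q₁ q₀) := by
  unfold diffMeans
  fun_prop

lemma continuous_diffMeans_perm (g : Equiv.Perm (Fin (q₁ + q₀))) :
    Continuous fun x : Fin (q₁ + q₀) → ℝ => diffMeans q₁ q₀ fun k => x (g k) :=
  continuous_diffMeans.comp (by fun_prop)

/-- Each of the finitely many strict comparisons is an open condition, and the identity never
counts. -/
lemma eventually_below_eq {x : Fin (q₁ + q₀) → ℝ} (hx : Nondegenerate q₁ q₀ x) :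
    ∀ᶠ y in 𝓝 x, below q₁ q₀ y = below q₁ q₀ x := by
  have h : ∀ g ∈ permSet q₁ q₀, ∀ᶠ y in 𝓝 x,
      (diffMeans q₁ q₀ (fun k => y (g k)) < diffMeans q₁ q₀ y ↔
        diffMeans q₁ q₀ (fun k => x (g k)) < diffMeans q₁ q₀ x) := by
    intro g hg
    by_cases h1 : g = 1
    · subst h1
      exact .of_forall fun y => iff_of_false (lt_irrefl _) (lt_irrefl _)
    rcases lt_or_gt_of_ne (hx g hg h1) with hlt | hlt
    · filter_upwards [(continuous_diffMeans_perm g).continuousAt.eventually_lt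
        continuous_diffMeans.continuousAt hlt] with y hy
      exact iff_of_true hy hlt
    · filter_upwards [continuous_diffMeans.continuousAt.eventually_lt
        (continuous_diffMeans_perm g).continuousAt hlt] with y hy
      exact iff_of_false hy.not_gt hlt.not_gt
  filter_upwards [(Filter.eventually_all_finset _).2 h] with y hy
  exact Finset.filter_congr hy

lemma measurableSet_le_card_below (q₁ q₀ j : ℕ) :
    MeasurableSet {x : Fin (q₁ + q₀) → ℝ | j ≤ (below q₁ q₀ x).card} := by
  classical
  have : (fun x : Fin (q₁ + q₀) → ℝ => (below q₁ q₀ x).card) = fun x => ∑ g ∈ permSet q₁ q₀,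
      if diffMeans q₁ q₀ (fun k => x (g k)) < diffMeans q₁ q₀ x then 1 else 0 := by
    ext x
    rw [below, Finset.card_filter]
  refine measurableSet_le measurable_const ?_
  rw [this]
  refine Finset.measurable_sum _ fun g _ => Measurable.ite ?_ measurable_const measurable_const
  exact measurableSet_lt (continuous_diffMeans_perm g).measurable continuous_diffMeans.measurable

lemma card_below_lt (x : Fin (q₁ + q₀) → ℝ) : (below q₁ q₀ x).card < (permSet q₁ q₀).card := by
  refine Finset.card_lt_card ((Finset.ssubset_iff_of_subset (Finset.filter_subset _ _)).2
    ⟨1, one_mem_permSet q₁ q₀, ?_⟩)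
  simp

lemma worstSize_zero (q₁ q₀ : ℕ) : worstSize q₁ q₀ 0 = 0 := by
  have h : critIndex q₁ q₀ 0 = (permSet q₁ q₀).card := by simp [critIndex]
  have hempty : {x | Rejects q₁ q₀ 0 x} = ∅ := by
    ext x
    rw [Set.mem_ofPred_eq, rejects_iff (by rw [h]; exact card_permSet_pos q₁ q₀) h.le, h]
    simpa using card_below_lt x
  simp [worstSize, hempty]

/-- The candidate set is finite and contains 0, since at `p = 0` the critical value is the maximum
over `𝔊` and is never exceeded. Hence the supremum is attained. -/
lemma alphaBar_mem (q₁ q₀ : ℕ) (α : ℝ) :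
    (∃ i : ℕ, i < (permSet q₁ q₀).card ∧ alphaBar q₁ q₀ α = i / (permSet q₁ q₀).card) ∧
      worstSize q₁ q₀ (alphaBar q₁ q₀ α) ≤ ENNReal.ofReal α := by
  let S := {p : ℝ | (∃ i : ℕ, i < (permSet q₁ q₀).card ∧ p = i / (permSet q₁ q₀).card) ∧
    worstSize q₁ q₀ p ≤ ENNReal.ofReal α}
  have hfin : S.Finite := by
    refine ((Set.finite_Iio (permSet q₁ q₀).card).image
      fun i : ℕ => (i : ℝ) / (permSet q₁ q₀).card).subset ?_
    rintro p ⟨⟨i, hi, rfl⟩, -⟩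
    exact ⟨i, hi, rfl⟩
  have hne : S.Nonempty := ⟨0, ⟨0, card_permSet_pos q₁ q₀, by simp⟩, by simp [worstSize_zero]⟩
  exact hne.csSup_mem hfin

lemma critIndex_alphaBar (q₁ q₀ : ℕ) (α : ℝ) :
    1 ≤ critIndex q₁ q₀ (alphaBar q₁ q₀ α) ∧
      critIndex q₁ q₀ (alphaBar q₁ q₀ α) ≤ (permSet q₁ q₀).card := by
  obtain ⟨⟨i, hi, hp⟩, -⟩ := alphaBar_mem q₁ q₀ α
  have hN : (0 : ℝ) < (permSet q₁ q₀).card := by exact_mod_cast card_permSet_pos q₁ q₀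
  have h : (1 - alphaBar q₁ q₀ α) * ((permSet q₁ q₀).card : ℝ) = (permSet q₁ q₀).card - i := by
    rw [hp]; field_simp
  have hi' : (i : ℝ) < (permSet q₁ q₀).card := by exact_mod_cast hi
  unfold critIndex
  rw [h]
  exact ⟨Nat.one_le_ceil_iff.2 (by linarith), Nat.ceil_le.2 (by linarith [i.cast_nonneg (α := ℝ)])⟩

/-- The number `|𝔊| - 1` is the count reached when the identity is the unique maximizer. -/
lemma critIndex_alphaBar_le_pred {α : ℝ}
    (h : 1 / ((permSet q₁ q₀).card : ℝ) ≤ alphaBar q₁ q₀ α) :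
    critIndex q₁ q₀ (alphaBar q₁ q₀ α) ≤ (permSet q₁ q₀).card - 1 := by
  have hN : (0 : ℝ) < (permSet q₁ q₀).card := by exact_mod_cast card_permSet_pos q₁ q₀
  have h' : 1 ≤ alphaBar q₁ q₀ α * (permSet q₁ q₀).card := (div_le_iff₀ hN).1 h
  refine Nat.ceil_le.2 ?_
  rw [Nat.cast_pred (card_permSet_pos q₁ q₀)]
  linarith

lemma rejects_alphaBar_iff {α : ℝ} (x : Fin (q₁ + q₀) → ℝ) :
    Rejects q₁ q₀ (alphaBar q₁ q₀ α) x ↔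
      critIndex q₁ q₀ (alphaBar q₁ q₀ α) ≤ (below q₁ q₀ x).card :=
  rejects_iff (critIndex_alphaBar q₁ q₀ α).1 (critIndex_alphaBar q₁ q₀ α).2 x


/-! ### Weak convergence and varying sets -/

section WeakConvergence

variable {E : Type*} [TopologicalSpace E] [MeasurableSpace E] [OpensMeasurableSpace E]
  [HasOuterApproxClosed E] {μ : ProbabilityMeasure E} {μs : ℕ → ProbabilityMeasure E}

/-- The open sets `U m`, of points near which membership in `B n` holds for all `n ≥ m`, increase
and cover almost all of `A`; the portmanteau inequality applies to each. -/
lemma le_liminf_measure_of_eventually_mem (h : Tendsto μs atTop (𝓝 μ)) {A : Set E}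
    {B : ℕ → Set E}
    (hA : ∀ᵐ z ∂(μ : Measure E), z ∈ A → ∀ᶠ p : ℕ × E in atTop ×ˢ 𝓝 z, p.2 ∈ B p.1) :
    (μ : Measure E) A ≤ liminf (fun n => (μs n : Measure E) (B n)) atTop := by
  let U : ℕ → Set E := fun m => interior {z | ∀ n ≥ m, z ∈ B n}
  have hU : Monotone U := fun a b hab => interior_mono fun z hz n hn => hz n (hab.trans hn)
  have hsub : A ≤ᵐ[(μ : Measure E)] (⋃ m, U m : Set E) := by
    filter_upwards [hA] with z hz hzA
    obtain ⟨pa, hpa, pb, hpb, hp⟩ := eventually_prod_iff.1 (hz hzA)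
    obtain ⟨m, hm⟩ := eventually_atTop.1 hpa
    refine Set.mem_iUnion.2 ⟨m, mem_interior_iff_mem_nhds.2 ?_⟩
    filter_upwards [hpb] with w hw n hn
    exact hp (hm n hn) hw
  refine (measure_mono_ae hsub).trans ?_
  rw [hU.measure_iUnion]
  refine iSup_le fun m => ?_
  refine (ProbabilityMeasure.le_liminf_measure_open_of_tendsto h isOpen_interior).trans ?_
  refine liminf_le_liminf ?_
  filter_upwards [eventually_ge_atTop m] with n hn
  exact measure_mono fun z hz => interior_subset hz n hn

/-- If the indicators of `B n` converge continuously to that of `A` almost everywhere under the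
weak limit, then the measures of `B n` converge to the measure of `A`. -/
theorem tendsto_measure_of_eventually_mem_iff (h : Tendsto μs atTop (𝓝 μ)) {A : Set E}
    (hAm : MeasurableSet A) {B : ℕ → Set E} (hB : ∀ n, MeasurableSet (B n))
    (hA : ∀ᵐ z ∂(μ : Measure E), ∀ᶠ p : ℕ × E in atTop ×ˢ 𝓝 z, (p.2 ∈ B p.1 ↔ z ∈ A)) :
    Tendsto (fun n => (μs n : Measure E) (B n)) atTop (𝓝 ((μ : Measure E) A)) := by
  have h1 := le_liminf_measure_of_eventually_mem h (A := A) (B := B) <| by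
    filter_upwards [hA] with z hz hzA
    filter_upwards [hz] with p hp
    exact hp.2 hzA
  have h2 := le_liminf_measure_of_eventually_mem h (A := Aᶜ) (B := fun n => (B n)ᶜ) <| by
    filter_upwards [hA] with z hz hzA
    filter_upwards [hz] with p hp
    exact fun hpB => hzA (hp.1 hpB)
  refine tendsto_of_le_liminf_of_limsup_le h1 ?_
  have hc : ∀ n, (μs n : Measure E) (B n) = 1 - (μs n : Measure E) (B n)ᶜ := fun n => by
    rw [← prob_compl_eq_one_sub (hB n).compl, compl_compl]
  simp_rw [hc]
  rw [ENNReal.limsup_const_sub (F := atTop) (fun n => (μs n : Measure E) (B n)ᶜ)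
    ENNReal.one_ne_top]
  refine (tsub_le_tsub_left h2 1).trans ?_
  rw [← prob_compl_eq_one_sub hAm.compl, compl_compl]

end WeakConvergence

/-! ### Null sets of atomless product measures -/

lemma pi_eq_zero_of_subsingleton_fibers {ι : Type*} [Fintype ι] [DecidableEq ι] {ν : ι → Measure ℝ}
    [∀ i, SigmaFinite (ν i)] [∀ i, NullSingletonClass (ν i)] {S : Set (ι → ℝ)} (hS : MeasurableSet S) (i : ι)
    (h : ∀ x, {t | Function.update x i t ∈ S}.Subsingleton) : Measure.pi ν S = 0 := by
  have hm : Measurable (S.indicator (1 : (ι → ℝ) → ℝ≥0∞)) := measurable_one.indicator hS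
  rw [← lintegral_indicator_one hS, lintegral_eq_lmarginal_univ (0 : ι → ℝ),
    lmarginal_erase' _ hm (Finset.mem_univ i)]
  have h0 : ∀ x : ι → ℝ, ∫⁻ t, S.indicator 1 (Function.update x i t) ∂(ν i) = 0 := by
    intro x
    have : (fun t => S.indicator (1 : (ι → ℝ) → ℝ≥0∞) (Function.update x i t)) =
        {t | Function.update x i t ∈ S}.indicator 1 := by
      ext t; simp [Set.indicator]
    rw [this]
    exact (lintegral_indicator_one (hS.preimage (measurable_update x))).trans
      ((h x).measure_zero _)
  simp [h0, lmarginal]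

/-- Some coordinate has a nonzero coefficient; moving it alone changes the value at a nonzero rate,
so each line in that direction carries at most one zero. -/
lemma pi_affine_linearMap_eq_zero {ι : Type*} [Fintype ι] [DecidableEq ι] {ν : ι → Measure ℝ}
    [∀ i, SigmaFinite (ν i)] [∀ i, NullSingletonClass (ν i)] {l : (ι → ℝ) →ₗ[ℝ] ℝ} (hl : l ≠ 0)
    {s : ι → ℝ} (hs : ∀ i, s i ≠ 0) (d : ι → ℝ) :
    Measure.pi ν {z | l (s * z + d) = 0} = 0 := by
  obtain ⟨i, hi⟩ : ∃ i, l (Pi.single i 1) ≠ 0 := by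
    by_contra! h
    exact hl (LinearMap.pi_ext' fun i => LinearMap.ext_ring (by simpa using h i))
  refine pi_eq_zero_of_subsingleton_fibers ?_ i fun x => ?_
  · have : Continuous l := l.continuous_of_finiteDimensional
    exact (isClosed_eq (by fun_prop) continuous_const).measurableSet
  · have hupd : ∀ t, l (s * Function.update x i t + d) =
        l (s * x + d) + s i * (t - x i) * l (Pi.single i 1) := by
      intro t
      rw [← smul_eq_mul (a := s i * (t - x i)), ← map_smul, ← map_add]
      congr 1
      ext k
      rcases eq_or_ne k i with rfl | hk
      · simp; ring
      · simp [hk]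
    intro t ht t' ht'
    rw [Set.mem_ofPred_eq, Set.mem_ofPred_eq, hupd] at ht ht'
    have : s i * l (Pi.single i 1) * (t - t') = 0 := by linear_combination ht - ht'
    have := (mul_eq_zero.1 this).resolve_left (mul_ne_zero (hs i) hi)
    linarith

/-! ### The quantile transform -/

/-- Right continuity makes the infimum attained; for `0 < t < 1` the limits of the cdf at `±∞` make
the set nonempty and bounded below. -/
lemma invCDF_le_iff (ν : Measure ℝ) {t : ℝ} (ht : t ∈ Set.Ioo (0 : ℝ) 1) (x : ℝ) :
    invCDF (cdf ν) t ≤ x ↔ t ≤ cdf ν x := by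
  obtain ⟨a, ha⟩ := ((tendsto_cdf_atBot ν).eventually_lt_const ht.1).exists
  obtain ⟨b, hb⟩ := ((tendsto_cdf_atTop ν).eventually_const_lt ht.2).exists
  have hne : {x | t ≤ cdf ν x}.Nonempty := ⟨b, hb.le⟩
  have hbdd : BddBelow {x | t ≤ cdf ν x} :=
    ⟨a, fun y hy => le_of_lt (lt_of_not_ge fun h => (ha.trans_le hy).not_ge (monotone_cdf ν h))⟩
  refine ⟨fun h => ?_, fun h => csInf_le hbdd h⟩
  have hright : ∀ᶠ y in 𝓝[>] x, t ≤ cdf ν y := by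
    filter_upwards [self_mem_nhdsWithin] with y hy
    obtain ⟨z, hz, hzy⟩ := exists_lt_of_csInf_lt hne (h.trans_lt hy)
    exact hz.trans (monotone_cdf ν hzy.le)
  have hc : Tendsto (cdf ν) (𝓝[>] x) (𝓝 (cdf ν x)) :=
    ((cdf ν).right_continuous x).mono_left (nhdsWithin_mono _ Set.Ioi_subset_Ici_self)
  exact ge_of_tendsto hc hright

lemma aemeasurable_invCDF (ν : Measure ℝ) :
    AEMeasurable (invCDF (cdf ν)) (volume.restrict (Set.Ioo (0 : ℝ) 1)) := by
  refine aemeasurable_restrict_of_monotoneOn measurableSet_Ioo fun s hs t ht hst => ?_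
  rw [invCDF_le_iff ν hs]
  exact hst.trans ((invCDF_le_iff ν ht _).1 le_rfl)

/-- The quantile transform: the inverse distribution function pushes the uniform distribution
forward to the original measure. -/
theorem map_invCDF (ν : Measure ℝ) [IsProbabilityMeasure ν] :
    (volume.restrict (Set.Ioo (0 : ℝ) 1)).map (invCDF (cdf ν)) = ν := by
  have : IsFiniteMeasure ((volume.restrict (Set.Ioo (0 : ℝ) 1)).map (invCDF (cdf ν))) := by
    infer_instance
  refine Measure.ext_of_Iic _ _ fun x => ?_
  rw [Measure.map_apply_of_aemeasurable (aemeasurable_invCDF ν) measurableSet_Iic,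
    Measure.restrict_apply₀' measurableSet_Ioo.nullMeasurableSet]
  have h : invCDF (cdf ν) ⁻¹' Set.Iic x ∩ Set.Ioo 0 1 = Set.Iic (cdf ν x) ∩ Set.Ioo 0 1 := by
    ext t
    exact and_congr_left fun ht => invCDF_le_iff ν ht x
  rw [h, ← ofReal_cdf]
  -- The set lies between `(0, F x)` and `(0, F x]`, which treats `F x = 1` and `F x < 1` alike.
  refine le_antisymm ?_ ?_
  · refine (measure_mono (t := Set.Ioc 0 (cdf ν x)) fun t ht => ⟨ht.2.1, ht.1⟩).trans ?_
    simp
  · refine le_trans ?_ (measure_mono (s := Set.Ioo 0 (cdf ν x)) fun t ht =>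
      ⟨ht.2.le, ht.1, ht.2.trans_le (cdf_le_one ν x)⟩)
    simp

lemma intervalIntegral_comp_invCDF (ν : Measure ℝ) [IsProbabilityMeasure ν] {h : ℝ → ℝ}
    (hh : Measurable h) : ∫ t in (0 : ℝ)..1, h (invCDF (cdf ν) t) = ∫ x, h x ∂ν := by
  rw [intervalIntegral.integral_of_le zero_le_one, integral_Ioc_eq_integral_Ioo]
  conv_rhs => rw [← map_invCDF ν]
  rw [integral_map (aemeasurable_invCDF ν) hh.aestronglyMeasurable]

/-! ### Treated entries against the maximum of the controls -/

lemma measurePreserving_finAppend (m n : ℕ) (ν : Measure ℝ) [IsProbabilityMeasure ν] :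
    MeasurePreserving (fun p : (Fin m → ℝ) × (Fin n → ℝ) => (Fin.append p.1 p.2 : Fin (m + n) → ℝ))
      ((Measure.pi fun _ => ν).prod (Measure.pi fun _ => ν)) (Measure.pi fun _ => ν) := by
  have hmeas : Measurable
      fun p : (Fin m → ℝ) × (Fin n → ℝ) => (Fin.append p.1 p.2 : Fin (m + n) → ℝ) := by
    refine measurable_pi_lambda _ fun k => ?_
    induction k using Fin.addCases with
    | left i => simp only [Fin.append_left]; fun_prop
    | right j => simp only [Fin.append_right]; fun_prop
  refine ⟨hmeas, (Measure.pi_eq fun s hs => ?_).symm⟩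
  rw [Measure.map_apply hmeas (MeasurableSet.univ_pi hs)]
  have : (fun p : (Fin m → ℝ) × (Fin n → ℝ) => (Fin.append p.1 p.2 : Fin (m + n) → ℝ)) ⁻¹'
      Set.univ.pi s = (Set.univ.pi fun i => s (Fin.castAdd n i)) ×ˢ
        (Set.univ.pi fun j => s (Fin.natAdd m j)) := by
    ext p
    simp only [Set.mem_preimage, Set.mem_univ_pi, Set.mem_prod]
    constructor
    · intro h
      exact ⟨fun i => by simpa using h (Fin.castAdd n i), fun j => by simpa using h (Fin.natAdd m j)⟩
    · rintro ⟨h1, h2⟩ k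
      induction k using Fin.addCases with
      | left i => simpa using h1 i
      | right j => simpa using h2 j
  rw [this, Measure.prod_prod, Measure.pi_pi, Measure.pi_pi, Fin.prod_univ_add]

lemma gaussian_affine_gt {s : ℝ} (hs : 0 < s) (δ m : ℝ) :
    gaussianReal 0 1 {a | m < s * a + δ} = ENNReal.ofReal (stdNormalCDF ((δ - m) / s)) := by
  have : NullSingletonClass (gaussianReal 0 1) := nullSingletonClass_gaussianReal one_ne_zero
  have h : {a : ℝ | m < s * a + δ} = (fun x => -x) ⁻¹' Set.Iio ((δ - m) / s) := by
    ext a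
    rw [Set.mem_ofPred_eq, Set.mem_preimage, Set.mem_Iio, lt_div_iff₀ hs]
    constructor <;> intro h <;> linarith
  rw [h, ← Measure.map_apply measurable_neg measurableSet_Iio, gaussianReal_map_neg, neg_zero,
    measure_congr Iio_ae_eq_Iic, stdNormalCDF, ofReal_cdf]

/-- The probability that independent normal treated entries all exceed the maximum of the
control entries, as an integral over the quantiles of that maximum. -/
theorem measureReal_max_lt (q₁ q₀ : ℕ) {s₁ : Fin q₁ → ℝ} (hs₁ : ∀ i, 0 < s₁ i)
    (s₀ : Fin q₀ → ℝ) (δ : ℝ) :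
    ((Measure.pi fun _ : Fin q₁ => gaussianReal 0 1).prod
      (Measure.pi fun _ : Fin q₀ => gaussianReal 0 1)).real
        {p | ∀ i, (⨆ k, s₀ k * p.2 k) < s₁ i * p.1 i + δ} =
      ∫ t in (0 : ℝ)..1, ∏ i : Fin q₁, stdNormalCDF ((δ - invCDF (maxCDF q₀ s₀) t) / s₁ i) := by
  have hM : Measurable fun z : Fin q₀ → ℝ => ⨆ k, s₀ k * z k :=
    Measurable.iSup fun k => (measurable_pi_apply k).const_mul _
  have hΦ : Measurable stdNormalCDF := (monotone_cdf _).measurable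
  have hΦ0 : ∀ x, 0 ≤ stdNormalCDF x := cdf_nonneg _
  let ν := (Measure.pi fun _ : Fin q₀ => gaussianReal 0 1).map fun z => ⨆ k, s₀ k * z k
  have : IsProbabilityMeasure ν := Measure.isProbabilityMeasure_map hM.aemeasurable
  let h : ℝ → ℝ := fun m => ∏ i : Fin q₁, stdNormalCDF ((δ - m) / s₁ i)
  have hh : Measurable h := by
    refine Finset.measurable_prod _ fun i _ => hΦ.comp ?_
    fun_prop
  have hh0 : ∀ m, 0 ≤ h m := fun m => Finset.prod_nonneg fun i _ => hΦ0 _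
  have hS : MeasurableSet {p : (Fin q₁ → ℝ) × (Fin q₀ → ℝ) |
      ∀ i, (⨆ k, s₀ k * p.2 k) < s₁ i * p.1 i + δ} := by
    rw [Set.ofPred_forall]
    refine MeasurableSet.iInter fun i => measurableSet_lt (hM.comp measurable_snd) ?_
    fun_prop
  change _ = ∫ t in (0 : ℝ)..1, h (invCDF (cdf ν) t)
  rw [intervalIntegral_comp_invCDF ν hh, integral_map hM.aemeasurable hh.aestronglyMeasurable,
    integral_eq_lintegral_of_nonneg_ae (.of_forall fun z => hh0 _)
      (hh.comp hM).aestronglyMeasurable, measureReal_def, Measure.prod_apply_symm hS]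
  congr 1
  -- With the control vector fixed, the section is a box, so independence turns its probability into
  -- a product.
  refine lintegral_congr fun z => ?_
  have : (fun x : Fin q₁ → ℝ => (x, z)) ⁻¹' {p : (Fin q₁ → ℝ) × (Fin q₀ → ℝ) |
      ∀ i, (⨆ k, s₀ k * p.2 k) < s₁ i * p.1 i + δ} =
      Set.univ.pi fun i => {a | (⨆ k, s₀ k * z k) < s₁ i * a + δ} := by
    ext x
    simp
  rw [this, Measure.pi_pi, ENNReal.ofReal_prod_of_nonneg fun i _ => hΦ0 _]
  exact Finset.prod_congr rfl fun i _ => gaussian_affine_gt (hs₁ i) δ _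


/-! ### Almost sure absence of ties -/

/-- The linear functional `x ↦ T(gx) - T(x)`. -/
noncomputable def permDiff (q₁ q₀ : ℕ) (g : Equiv.Perm (Fin (q₁ + q₀))) :
    (Fin (q₁ + q₀) → ℝ) →ₗ[ℝ] ℝ where
  toFun x := diffMeans q₁ q₀ (fun k => x (g k)) - diffMeans q₁ q₀ x
  map_add' x y := by
    simp only [diffMeans, Pi.add_apply, Finset.sum_add_distrib]
    ring
  map_smul' a x := by
    simp only [diffMeans, Pi.smul_apply, smul_eq_mul, ← Finset.mul_sum, RingHom.id_apply]
    ring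

/-- The indicator of the treated block is separated by the threshold 0, so the functional is
strictly negative there. -/
lemma permDiff_ne_zero (hq₁ : 1 ≤ q₁) (hq₀ : 1 ≤ q₀) {g : Equiv.Perm (Fin (q₁ + q₀))}
    (hg : g ∈ permSet q₁ q₀) (h1 : g ≠ 1) : permDiff q₁ q₀ g ≠ 0 := by
  intro h
  have hlt := diffMeans_perm_lt hq₁ hq₀ (x := fun k => if (k : ℕ) < q₁ then 1 else 0) (c := 0)
    (fun i => by simp) (fun j => by simp) hg h1
  have := LinearMap.congr_fun h (fun k : Fin (q₁ + q₀) => if (k : ℕ) < q₁ then (1 : ℝ) else 0)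
  change _ - _ = (0 : ℝ) at this
  linarith

lemma nullSingletonClass_stdGaussian : NullSingletonClass (gaussianReal 0 1) :=
  nullSingletonClass_gaussianReal one_ne_zero

lemma ae_nondegenerate_affine (hq₁ : 1 ≤ q₁) (hq₀ : 1 ≤ q₀) {s : Fin (q₁ + q₀) → ℝ}
    (hs : ∀ k, s k ≠ 0) (d : Fin (q₁ + q₀) → ℝ) :
    ∀ᵐ z ∂(Measure.pi fun _ : Fin (q₁ + q₀) => gaussianReal 0 1),
      Nondegenerate q₁ q₀ (s * z + d) := by
  have := nullSingletonClass_stdGaussian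
  refine (Finset.eventually_all _).2 fun g hg => ?_
  by_cases h1 : g = 1
  · exact .of_forall fun z h => absurd h1 h
  have h0 := pi_affine_linearMap_eq_zero (ν := fun _ : Fin (q₁ + q₀) => gaussianReal 0 1)
    (permDiff_ne_zero hq₁ hq₀ hg h1) hs d
  filter_upwards [measure_eq_zero_iff_ae_notMem.1 h0] with z hz _ heq
  exact hz (sub_eq_zero.2 heq)

/-! ### Limit of the rejection probability -/

section Convergence

variable {σ : Fin (q₁ + q₀) → ℝ → ℝ} {Ω : ℕ → Type*} [∀ n, MeasurableSpace (Ω n)]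
  {P : (n : ℕ) → ℝ × ℝ → Measure (Ω n)} [∀ n θ, IsProbabilityMeasure (P n θ)]
  {θhat : (n : ℕ) → Ω n → Fin (q₁ + q₀) → ℝ}

lemma JointConv.tendsto_measure {θ : ℕ → ℝ × ℝ} (hC : JointConv q₁ q₀ σ P θhat θ)
    {A : Set (Fin (q₁ + q₀) → ℝ)} (hA : MeasurableSet A) {B : ℕ → Set (Fin (q₁ + q₀) → ℝ)}
    (hB : ∀ n, MeasurableSet (B n))
    (h : ∀ᵐ z ∂(Measure.pi fun _ : Fin (q₁ + q₀) => gaussianReal 0 1),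
      ∀ᶠ p : ℕ × (Fin (q₁ + q₀) → ℝ) in atTop ×ˢ 𝓝 z, (p.2 ∈ B p.1 ↔ z ∈ A)) :
    Tendsto (fun n => (P n (θ n)) {ω | standardize q₁ q₀ σ n (θ n) (θhat n ω) ∈ B n}) atTop
      (𝓝 ((Measure.pi fun _ : Fin (q₁ + q₀) => gaussianReal 0 1) A)) := by
  have key := tendsto_measure_of_eventually_mem_iff hC.tendsto hA hB (by simpa using h)
  simp only [ProbabilityMeasure.coe_mk, Measure.map_id] at key
  refine key.congr fun n => ?_
  rw [Measure.map_apply_of_aemeasurable (hC.forall_aemeasurable n) (hB n)]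
  rfl

/-- Division by zero returns 0, so a vanishing scale would make this standardized coordinate
identically 0, while the limit law charges `{z k ≠ 0}`, an open set, with mass 1. -/
lemma JointConv.scale_ne_zero {θ : ℝ × ℝ} (hC : JointConv q₁ q₀ σ P θhat fun _ => θ)
    (k : Fin (q₁ + q₀)) : σ k (clusterParam q₁ q₀ θ k) ≠ 0 := by
  intro h0
  have hmeas : MeasurableSet {z : Fin (q₁ + q₀) → ℝ | z k ≠ 0} :=
    (isOpen_ne_fun (continuous_apply k) continuous_const).measurableSet
  have hae : ∀ᵐ z ∂(Measure.pi fun _ : Fin (q₁ + q₀) => gaussianReal 0 1), z k ≠ 0 := by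
    have := nullSingletonClass_stdGaussian
    refine (measure_eq_zero_iff_ae_notMem (s := {z | z k = 0})).1
      (pi_eq_zero_of_subsingleton_fibers (ν := fun _ => gaussianReal 0 1) ?_ k fun x t ht t' ht' => ?_)
    · exact (isClosed_eq (continuous_apply k) continuous_const).measurableSet
    · simp only [Set.mem_ofPred_eq, Function.update_self] at ht ht'
      rw [ht, ht']
  have := hC.tendsto_measure (A := Set.univ) .univ (B := fun _ => {z | z k ≠ 0})
    (fun _ => hmeas) <| by
      filter_upwards [hae] with z hz
      filter_upwards [tendsto_snd.eventually ((continuous_apply k).continuousAt.eventually_ne hz)]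
        with p hp
      simpa using hp
  simp [standardize, h0] at this

/-- Convergence of the rejection probability when the estimates are, up to transformations that
leave the test decision unchanged, continuously convergent functions of the standardized ones. -/
theorem JointConv.tendsto_rejProb {θ : ℕ → ℝ × ℝ} (hC : JointConv q₁ q₀ σ P θhat θ) (α : ℝ)
    {y : ℕ → (Fin (q₁ + q₀) → ℝ) → Fin (q₁ + q₀) → ℝ} (hy : ∀ n, Measurable (y n))
    {Y : (Fin (q₁ + q₀) → ℝ) → Fin (q₁ + q₀) → ℝ} (hY : Measurable Y)
    (hbelow : ∀ᶠ n in atTop, ∀ x,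
      below q₁ q₀ (y n (standardize q₁ q₀ σ n (θ n) x)) = below q₁ q₀ x)
    (hlim : ∀ z, Tendsto (fun p : ℕ × (Fin (q₁ + q₀) → ℝ) => y p.1 p.2) (atTop ×ˢ 𝓝 z) (𝓝 (Y z)))
    (hnd : ∀ᵐ z ∂(Measure.pi fun _ : Fin (q₁ + q₀) => gaussianReal 0 1),
      Nondegenerate q₁ q₀ (Y z)) :
    Tendsto (fun n => rejProb q₁ q₀ α P θhat n (θ n)) atTop
      (𝓝 ((Measure.pi fun _ : Fin (q₁ + q₀) => gaussianReal 0 1).real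
        {z | Rejects q₁ q₀ (alphaBar q₁ q₀ α) (Y z)})) := by
  have hR := measurableSet_le_card_below q₁ q₀ (critIndex q₁ q₀ (alphaBar q₁ q₀ α))
  have key := hC.tendsto_measure (hY hR) (fun n => hy n hR) <| by
    filter_upwards [hnd] with z hz
    -- For large `n` and arguments near `z`, `y n` lies near `Y z`, where the count is constant.
    filter_upwards [(hlim z).eventually (eventually_below_eq hz)] with p hp
    simp only [Set.mem_preimage, Set.mem_ofPred_eq, hp]
  have key' := (ENNReal.tendsto_toReal (measure_ne_top _ _)).comp key
  simp only [rejProb, rejects_alphaBar_iff]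
  refine key'.congr' ?_
  filter_upwards [hbelow] with n hn
  simp [Measure.real, hn]

end Convergence

/-! ### Bounds on the limiting rejection probability -/

lemma clusterParam_castAdd (θ : ℝ × ℝ) (i : Fin q₁) :
    clusterParam q₁ q₀ θ (Fin.castAdd q₀ i) = θ.1 := by
  simp [clusterParam]

lemma clusterParam_natAdd (θ : ℝ × ℝ) (j : Fin q₀) :
    clusterParam q₁ q₀ θ (Fin.natAdd q₁ j) = θ.2 := by
  simp [clusterParam]

/-- Only `s k ≠ 0` is available in part (i); absolute values give the positive standard deviations
over which the worst-case size ranges. -/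
lemma map_mul_stdGaussian {q : ℕ} (s : Fin q → ℝ) :
    (Measure.pi fun _ : Fin q => gaussianReal 0 1).map (fun z => s * z) =
      normalLaw 0 fun k => |s k| := by
  have h : ∀ k, (gaussianReal 0 1).map (s k * ·) = gaussianReal 0 (|s k| ^ 2).toNNReal := by
    intro k
    rw [gaussianReal_map_const_mul, mul_zero, mul_one]
    congr 1
    ext
    simp [sq_nonneg]
  unfold normalLaw
  simp_rw [← h]
  rw [← Measure.pi_map_pi fun k => by fun_prop]
  rfl

lemma measureReal_rejects_scale_le {α : ℝ} (hα : 0 ≤ α) {s : Fin (q₁ + q₀) → ℝ}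
    (hs : ∀ k, s k ≠ 0) :
    (Measure.pi fun _ : Fin (q₁ + q₀) => gaussianReal 0 1).real
      {z | Rejects q₁ q₀ (alphaBar q₁ q₀ α) (s * z)} ≤ α := by
  refine ENNReal.toReal_le_of_le_ofReal hα (le_trans ?_ (alphaBar_mem q₁ q₀ α).2)
  have hR : MeasurableSet {x | Rejects q₁ q₀ (alphaBar q₁ q₀ α) x} := by
    simp only [rejects_alphaBar_iff]
    exact measurableSet_le_card_below _ _ _
  have hm : Measurable fun z : Fin (q₁ + q₀) → ℝ => s * z := by fun_prop
  have := Measure.map_apply (μ := Measure.pi fun _ : Fin (q₁ + q₀) => gaussianReal 0 1) hm hR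
  rw [Set.preimage_ofPred_eq] at this
  rw [← this, map_mul_stdGaussian]
  exact le_iSup_of_le 0 (le_iSup_of_le (fun k => |s k|)
    (le_iSup_of_le (fun k => abs_pos.2 (hs k)) le_rfl))

lemma rejects_of_separated (hq₁ : 1 ≤ q₁) (hq₀ : 1 ≤ q₀) {α : ℝ}
    (h : 1 / ((permSet q₁ q₀).card : ℝ) ≤ alphaBar q₁ q₀ α) {x : Fin (q₁ + q₀) → ℝ} {c : ℝ}
    (hfirst : ∀ i, c < x (Fin.castAdd q₀ i)) (hlast : ∀ j, x (Fin.natAdd q₁ j) ≤ c) :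
    Rejects q₁ q₀ (alphaBar q₁ q₀ α) x := by
  rw [rejects_alphaBar_iff, below_eq_erase hq₁ hq₀ hfirst hlast]
  exact critIndex_alphaBar_le_pred h

lemma quantile_integral_le_measureReal_rejects (hq₁ : 1 ≤ q₁) (hq₀ : 1 ≤ q₀) {α : ℝ}
    (h : 1 / ((permSet q₁ q₀).card : ℝ) ≤ alphaBar q₁ q₀ α) {s d : Fin (q₁ + q₀) → ℝ}
    (hs : ∀ k, 0 < s k) {δ : ℝ} (hd₁ : ∀ i, d (Fin.castAdd q₀ i) = δ)
    (hd₀ : ∀ j, d (Fin.natAdd q₁ j) = 0) :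
    ∫ t in (0 : ℝ)..1, ∏ j : Fin q₁, stdNormalCDF
        ((δ - invCDF (maxCDF q₀ fun k => s (Fin.natAdd q₁ k)) t) / s (Fin.castAdd q₀ j)) ≤
      (Measure.pi fun _ : Fin (q₁ + q₀) => gaussianReal 0 1).real
        {z | Rejects q₁ q₀ (alphaBar q₁ q₀ α) (s * z + d)} := by
  have hR : MeasurableSet {z | Rejects q₁ q₀ (alphaBar q₁ q₀ α) (s * z + d)} := by
    simp only [rejects_alphaBar_iff]
    have hm : Measurable fun z : Fin (q₁ + q₀) → ℝ => s * z + d := by fun_prop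
    exact hm (measurableSet_le_card_below _ _ _)
  rw [← measureReal_max_lt q₁ q₀ (fun i => hs (Fin.castAdd q₀ i)),
    ← (measurePreserving_finAppend q₁ q₀ (gaussianReal 0 1)).measureReal_preimage
      hR.nullMeasurableSet]
  refine measureReal_mono fun p hp => ?_
  refine rejects_of_separated hq₁ hq₀ h (c := ⨆ k, s (Fin.natAdd q₁ k) * p.2 k)
    (fun i => ?_) fun j => ?_
  · simpa [hd₁] using hp i
  · simpa [hd₀] using le_ciSup
      (Set.finite_range fun k => s (Fin.natAdd q₁ k) * p.2 k).bddAbove j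

end PermTest

theorem theorem3
    (q₁ q₀ : ℕ) (hq₁ : 1 ≤ q₁) (hq₀ : 1 ≤ q₀)
    (α : ℝ) (hα : α ∈ Set.Ioo (0 : ℝ) 1)
    {Ω : ℕ → Type*} [∀ n, MeasurableSpace (Ω n)]
    (P : (n : ℕ) → ℝ × ℝ → Measure (Ω n)) [∀ n θ, IsProbabilityMeasure (P n θ)]
    (θhat : (n : ℕ) → Ω n → Fin (q₁ + q₀) → ℝ) (hθhat : ∀ n, Measurable (θhat n))
    (σ : Fin (q₁ + q₀) → ℝ → ℝ) (θ₀ : ℝ) :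
    -- asymptotic size under `θ₁ = θ₀`
    (PermTest.JointConv q₁ q₀ σ P θhat (fun _ => (θ₀, θ₀)) →
      ∃ L : ℝ, Tendsto (fun n => PermTest.rejProb q₁ q₀ α P θhat n (θ₀, θ₀)) atTop (𝓝 L) ∧
        L ≤ α) ∧
    (1 / ((PermTest.permSet q₁ q₀).card : ℝ) ≤ PermTest.alphaBar q₁ q₀ α →
      -- consistency under `θ₁ = θ₀ + δ` with `δ > 0`
      (∀ δ : ℝ, 0 < δ → PermTest.JointConv q₁ q₀ σ P θhat (fun _ => (θ₀ + δ, θ₀)) →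
        Tendsto (fun n => PermTest.rejProb q₁ q₀ α P θhat n (θ₀ + δ, θ₀)) atTop (𝓝 1)) ∧
      -- power under the local alternatives `θ₁ = θ₀ + δ / √n`
      (∀ δ : ℝ,
        PermTest.JointConv q₁ q₀ σ P θhat (fun n => (θ₀ + δ / √(n : ℝ), θ₀)) →
        (∀ k, ContinuousAt (σ k) θ₀ ∧ 0 < σ k θ₀) →
        ∃ L : ℝ,
          Tendsto (fun n => PermTest.rejProb q₁ q₀ α P θhat n (θ₀ + δ / √(n : ℝ), θ₀))
            atTop (𝓝 L) ∧
          ∫ t in (0 : ℝ)..1, ∏ j : Fin q₁, PermTest.stdNormalCDF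
              ((δ - PermTest.invCDF
                  (PermTest.maxCDF q₀ fun k => σ (Fin.natAdd q₁ k) θ₀) t) /
                σ (Fin.castAdd q₀ j) θ₀) ≤ L)) := by
  open PermTest in
  have hsqrt : ∀ {n : ℕ}, 1 ≤ n → 0 < √(n : ℝ) := fun hn => Real.sqrt_pos.2 (by positivity)
  have hsqrt_top : Tendsto (fun n : ℕ => √(n : ℝ)) atTop atTop :=
    Real.tendsto_sqrt_atTop.comp tendsto_natCast_atTop_atTop
  refine ⟨fun hC => ?_, fun hbar => ⟨fun δ hδ hC => ?_, fun δ hC hσ => ?_⟩⟩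
  · let s : Fin (q₁ + q₀) → ℝ := fun k => σ k θ₀
    have hs : ∀ k, s k ≠ 0 := fun k => by simpa [clusterParam] using hC.scale_ne_zero k
    refine ⟨_, hC.tendsto_rejProb α (y := fun _ z => s * z) (Y := fun z => s * z)
      (fun _ => by fun_prop) (by fun_prop) ?_ (fun z => ?_) ?_,
      measureReal_rejects_scale_le hα.1.le hs⟩
    · filter_upwards [eventually_ge_atTop 1] with n hn x
      rw [← below_affine hq₁ hq₀ (hsqrt hn) θ₀ x]
      congr 1
      ext k
      have := hs k
      simp only [Pi.mul_apply, standardize, clusterParam, ite_self, s] at this ⊢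
      field_simp
    · exact ((continuous_const.mul continuous_id).tendsto z).comp tendsto_snd
    · simpa using ae_nondegenerate_affine hq₁ hq₀ hs 0
  · let c : Fin (q₁ + q₀) → ℝ := clusterParam q₁ q₀ (θ₀ + δ, θ₀)
    let s : Fin (q₁ + q₀) → ℝ := fun k => σ k (c k)
    have hs : ∀ k, s k ≠ 0 := fun k => hC.scale_ne_zero k
    have hfirst : ∀ i, θ₀ < c (Fin.castAdd q₀ i) := fun i => by
      simp only [c, clusterParam_castAdd]; linarith
    have hlast : ∀ j, c (Fin.natAdd q₁ j) ≤ θ₀ := fun j => by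
      simp only [c, clusterParam_natAdd]; exact le_rfl
    -- Here `y n` recovers the estimate itself; its noise is of order `1/√n`, so the limit is the
    -- deterministic vector `c`.
    have key := hC.tendsto_rejProb α (y := fun n z k => c k + s k * z k / √(n : ℝ))
      (Y := fun _ => c) (fun _ => by fun_prop) (by fun_prop) ?_ (fun z => ?_) ?_
    · simpa [rejects_of_separated hq₁ hq₀ hbar hfirst hlast] using key
    · filter_upwards [eventually_ge_atTop 1] with n hn x
      congr 1
      ext k
      have := hs k
      have := (hsqrt hn).ne'
      simp only [standardize, s, c] at *
      field_simp
      ring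
    · refine tendsto_pi_nhds.2 fun k => ?_
      have h1 : Tendsto (fun p : ℕ × (Fin (q₁ + q₀) → ℝ) => s k * p.2 k) (atTop ×ˢ 𝓝 z)
          (𝓝 (s k * z k)) :=
        (((continuous_apply k).tendsto z).comp tendsto_snd).const_mul _
      have h2 := h1.div_atTop (hsqrt_top.comp tendsto_fst)
      simpa using h2.const_add (c k)
    · exact .of_forall fun _ g hg h1 => (diffMeans_perm_lt hq₁ hq₀ hfirst hlast hg h1).ne
  · let c : ℕ → Fin (q₁ + q₀) → ℝ := fun n => clusterParam q₁ q₀ (θ₀ + δ / √(n : ℝ), θ₀)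
    let s : Fin (q₁ + q₀) → ℝ := fun k => σ k θ₀
    let d : Fin (q₁ + q₀) → ℝ := clusterParam q₁ q₀ (δ, 0)
    have hs : ∀ k, s k ≠ 0 := fun k => (hσ k).2.ne'
    have hc : ∀ k, Tendsto (fun n => c n k) atTop (𝓝 θ₀) := fun k => by
      simp only [c, clusterParam]
      split_ifs
      · simpa using (tendsto_const_nhds.div_atTop hsqrt_top).const_add θ₀
      · exact tendsto_const_nhds
    have hσc : ∀ k, Tendsto (fun n => σ k (c n k)) atTop (𝓝 (s k)) := fun k =>
      (hσ k).1.tendsto.comp (hc k)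
    -- Here `y n` is `√n (θ̂ - θ₀)` once the scales are nonzero, which continuity at `θ₀` gives for
    -- large `n`.
    refine ⟨_, hC.tendsto_rejProb α (y := fun n z k => σ k (c n k) * z k + d k)
      (Y := fun z => s * z + d) (fun _ => by fun_prop) (by fun_prop) ?_ (fun z => ?_)
      (ae_nondegenerate_affine hq₁ hq₀ hs d),
      quantile_integral_le_measureReal_rejects hq₁ hq₀ hbar (fun k => (hσ k).2)
        (fun i => clusterParam_castAdd _ i) (fun j => clusterParam_natAdd _ j)⟩
    · filter_upwards [eventually_ge_atTop 1,
        eventually_all.2 fun k => (hσc k).eventually_ne (hs k)] with n hn hne x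
      rw [← below_affine hq₁ hq₀ (hsqrt hn) θ₀ x]
      congr 1
      ext k
      have h1 := hne k
      have h2 := (hsqrt hn).ne'
      -- The drift `d` is exact for each `n ≥ 1`; only the scales vary with `n`.
      have h3 : √(n : ℝ) * (c n k - θ₀) = d k := by
        simp only [c, d, clusterParam]
        split_ifs
        · field_simp; ring
        · ring
      rw [← h3]
      change σ k (c n k) * (√(n : ℝ) * ((x k - c n k) / σ k (c n k))) + _ = _
      field_simp
      ring
    · refine tendsto_pi_nhds.2 fun k => ?_
      exact (((hσc k).comp tendsto_fst).mul
        (((continuous_apply k).tendsto z).comp tendsto_snd)).add_const (d k)
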